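/- Let $X$ be an infinite-dimensional complex Banach space and let $T\in L(X)$ be a bounded linear operator on $X$. For a bounded operator $S$ on a Banach space write $\alpha(S)=\dim\ker S$, $\beta(S)=\operatorname{codim} R(S)$, where $R(S)$ is the range, and $\operatorname{ind}S=\alpha(S)-\beta(S)$ when $\alpha(S)<\infty$. The operator $S$ is upper semi-Fredholm if $\alpha(S)<\infty$ and $R(S)$ is closed; upper semi-Weyl if it is upper semi-Fredholm with $\operatorname{ind}S\le 0$; Weyl if it is Fredholm with $\operatorname{ind}S=0$; and upper semi-B-Weyl if for some integer $n\ge 0$ the space $R(S^n)$ is closed and the operator $R(S^n)\to R(S^n)$, $x\mapsto Sx$, is upper semi-Fredholm of index $\le 0$. The ascent and the descent of $S$ are $p(S)=\inf\{n\ge 0:\ker S^n=\ker S^{n+1}\}$ and $q(S)=\inf\{n\ge 0: R(S^n)=R(S^{n+1})\}$, with $\inf\emptyset=\infty$. Let $\sigma(T)$ be the spectrum of $T$ and let $\sigma_a(T)$, $\sigma_w(T)$, $\sigma_{uw}(T)$, $\sigma_{ubw}(T)$ be the sets of $\lambda\in\mathbb C$ for which $T-\lambda I$ is, respectively, not bounded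 below, not Weyl, not upper semi-Weyl, not upper semi-B-Weyl. Put $$\Delta(T)=\sigma(T)\setminus\sigma_w(T),\qquad \Delta_a(T)=\sigma_a(T)\setminus\sigma_{uw}(T),\qquad \Delta_a^g(T)=\sigma_a(T)\setminus\sigma_{ubw}(T).$$ Let $\Pi(T)$ be the set of poles of $T$, that is, of $\lambda\in\sigma(T)$ such that $p(T-\lambda I)<\infty$ and $q(T-\lambda I)<\infty$, and let $\Pi_a(T)$ be the set of left poles of $T$, that is, of $\lambda\in\sigma_a(T)$ such that $p=p(T-\lambda I)<\infty$ and $R((T-\lambda I)^{p+1})$ is closed. Say that $T$ satisfies property $(gb)$ if $\Delta_a^g(T)=\Pi(T)$, property $(UW_\Pi)$ if $\Delta_a(T)=\Pi(T)$, and property $(Z_{\Pi_a})$ if $\Delta(T)=\Pi_a(T)$. Then: (i) If $T$ satisfies property $(gb)$, then $T$ satisfies $(UW_\Pi)$ if and only if $T$ satisfies $(Z_{\Pi_a})$. (ii) If $T$ satisfies both $(UW_\Pi)$ and $(Z_{\Pi_a})$, then $T$ satisfies $(gb)$. (iii) If $T$ satisfies $(Z_{\Pi_a})$, then $\Pi(T)\subset\Delta_a(T)$.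 -/

import Mathlib

namespace WeylType

section Basic

variable {E : Type*} [NormedAddCommGroup E] [NormedSpace ℂ E]

/-- The nullity `α(S)`: the dimension of the kernel, with value `⊤` if it is infinite. -/
noncomputable def nullity (S : E →L[ℂ] E) : ℕ∞ :=
  Cardinal.toENat (Module.rank ℂ S.ker)

/-- The deficiency `β(S)`: the codimension of the range, with value `⊤` if it is infinite. -/
noncomputable def deficiency (S : E →L[ℂ] E) : ℕ∞ :=
  Cardinal.toENat (Module.rank ℂ (E ⧸ S.range))

/-- The index `α(S) - β(S)`, an extended real number. It is only used for operators of finite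
nullity, where the subtraction has its usual meaning (and the index is `⊥ = -∞` if the deficiency
is infinite). -/
noncomputable def index (S : E →L[ℂ] E) : EReal :=
  ((nullity S : ENNReal) : EReal) - ((deficiency S : ENNReal) : EReal)

/-- Upper semi-Fredholm operators: finite-dimensional kernel and closed range. -/
def IsUpperSemiFredholm (S : E →L[ℂ] E) : Prop :=
  nullity S < ⊤ ∧ IsClosed (S.range : Set E)

/-- Upper semi-Weyl operators: upper semi-Fredholm of index at most `0`. -/
def IsUpperSemiWeyl (S : E →L[ℂ] E) : Prop :=
  IsUpperSemiFredholm S ∧ index S ≤ 0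

/-- Weyl operators: Fredholm of index `0`. -/
def IsWeyl (S : E →L[ℂ] E) : Prop :=
  S.IsFredholm ∧ index S = 0

/-- `S` maps the range of `S ^ n` into itself. -/
theorem mapsTo_range_pow (S : E →L[ℂ] E) (n : ℕ) :
    ∀ x ∈ (S ^ n).range, S x ∈ (S ^ n).range := by
  rintro _ ⟨y, rfl⟩
  refine ⟨S y, ?_⟩
  change (S ^ n * S) y = (S * S ^ n) y
  rw [← pow_succ, ← pow_succ']

/-- The operator `S_[n]` induced by `S` on the range of `S ^ n`. -/
noncomputable def restrictRangePow (S : E →L[ℂ] E) (n : ℕ) :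
    (S ^ n).range →L[ℂ] (S ^ n).range :=
  (S.comp (S ^ n).range.subtypeL).codRestrict (S ^ n).range
    fun x => mapsTo_range_pow S n x x.2

/-- Upper semi-B-Weyl operators: for some `n` the range of `S ^ n` is closed and the operator
`S_[n]` induced on it is upper semi-Fredholm of index at most `0`. -/
def IsUpperSemiBWeyl (S : E →L[ℂ] E) : Prop :=
  ∃ n : ℕ, IsClosed ((S ^ n).range : Set E) ∧
    IsUpperSemiFredholm (restrictRangePow S n) ∧ index (restrictRangePow S n) ≤ 0

/-- The ascent `p(S)`, with value `⊤` if there is no `n` with `ker (S ^ n) = ker (S ^ (n + 1))`. -/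
noncomputable def ascent (S : E →L[ℂ] E) : ℕ∞ :=
  ⨅ (n : ℕ) (_ : (S ^ n).ker = (S ^ (n + 1)).ker), (n : ℕ∞)

/-- The descent `q(S)`, with value `⊤` if there is no `n` for which the ranges of `S ^ n` and
`S ^ (n + 1)` agree. -/
noncomputable def descent (S : E →L[ℂ] E) : ℕ∞ :=
  ⨅ (n : ℕ) (_ : (S ^ n).range = (S ^ (n + 1)).range), (n : ℕ∞)

/-- Drazin invertible operators: finite ascent and finite descent. -/
def IsDrazinInvertible (S : E →L[ℂ] E) : Prop :=
  ascent S < ⊤ ∧ descent S < ⊤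

/-- Left Drazin invertible operators: the ascent `p` is finite and the range of `S ^ (p + 1)` is
closed. -/
def IsLeftDrazinInvertible (S : E →L[ℂ] E) : Prop :=
  ∃ p : ℕ, ascent S = p ∧ IsClosed ((S ^ (p + 1)).range : Set E)

/-- `S` is bounded below. -/
def IsBoundedBelow (S : E →L[ℂ] E) : Prop :=
  ∃ c : ℝ, 0 < c ∧ ∀ x : E, c * ‖x‖ ≤ ‖S x‖

end Basic

section Spectra

variable {X : Type*} [NormedAddCommGroup X] [NormedSpace ℂ X]

/-- The operator `T - μ I`. -/
noncomputable def shift (T : X →L[ℂ] X) (μ : ℂ) : X →L[ℂ] X :=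
  T - μ • ContinuousLinearMap.id ℂ X

/-- The approximate point spectrum `σ_a(T)`. -/
def approxSpectrum (T : X →L[ℂ] X) : Set ℂ := {μ | ¬ IsBoundedBelow (shift T μ)}

/-- The Weyl spectrum `σ_w(T)`. -/
def weylSpectrum (T : X →L[ℂ] X) : Set ℂ := {μ | ¬ IsWeyl (shift T μ)}

/-- The upper semi-Weyl spectrum `σ_uw(T)`. -/
def upperSemiWeylSpectrum (T : X →L[ℂ] X) : Set ℂ := {μ | ¬ IsUpperSemiWeyl (shift T μ)}

/-- The upper semi-B-Weyl spectrum `σ_ubw(T)`. -/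
def upperSemiBWeylSpectrum (T : X →L[ℂ] X) : Set ℂ := {μ | ¬ IsUpperSemiBWeyl (shift T μ)}

/-- The Drazin spectrum `σ_d(T)`. -/
def drazinSpectrum (T : X →L[ℂ] X) : Set ℂ := {μ | ¬ IsDrazinInvertible (shift T μ)}

/-- The left Drazin spectrum `σ_ld(T)`. -/
def leftDrazinSpectrum (T : X →L[ℂ] X) : Set ℂ := {μ | ¬ IsLeftDrazinInvertible (shift T μ)}

/-- The set `Π(T)` of poles of `T`: the points `μ` of the spectrum for which `T - μ I` has finite
ascent and finite descent. -/
def poles (T : X →L[ℂ] X) : Set ℂ := spectrum ℂ T \ drazinSpectrum T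

/-- The set `Π_a(T)` of left poles of `T`: the points `μ` of the approximate point spectrum for
which `T - μ I` is left Drazin invertible. -/
def leftPoles (T : X →L[ℂ] X) : Set ℂ := approxSpectrum T \ leftDrazinSpectrum T

/-- `Δ(T) = σ(T) \ σ_w(T)`. -/
def delta (T : X →L[ℂ] X) : Set ℂ := spectrum ℂ T \ weylSpectrum T

/-- `Δ_a(T) = σ_a(T) \ σ_uw(T)`. -/
def deltaA (T : X →L[ℂ] X) : Set ℂ := approxSpectrum T \ upperSemiWeylSpectrum T

/-- `Δ_a^g(T) = σ_a(T) \ σ_ubw(T)`. -/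
def deltaAG (T : X →L[ℂ] X) : Set ℂ := approxSpectrum T \ upperSemiBWeylSpectrum T

/-- Property `(gb)`: `Δ_a^g(T) = Π(T)`. -/
def PropertyGB (T : X →L[ℂ] X) : Prop := deltaAG T = poles T

/-- Property `(UW_Π)`: `Δ_a(T) = Π(T)`. -/
def PropertyUWPi (T : X →L[ℂ] X) : Prop := deltaA T = poles T

/-- Property `(Z_{Π_a})`: `Δ(T) = Π_a(T)`. -/
def PropertyZPiA (T : X →L[ℂ] X) : Prop := delta T = leftPoles T

end Spectra

end WeylType

/-!
Poles are left poles, left poles belong to `Δ_a^g(T)`, and `Δ(T) ⊆ Δ_a(T) ⊆ Δ_a^g(T)`. Moreover a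
point of `Δ_a(T)` that is a pole belongs to `Δ(T)`, because a Drazin invertible operator with
finite-dimensional kernel is Weyl. These inclusions give (i), (iii), and the inclusion
`Π(T) ⊆ Δ_a^g(T)` in (ii). The remaining inclusion of (ii) needs one more fact: if all points of
`Δ_a(T)` are poles, then all points of `Δ_a^g(T)` are left poles (`deltaAG_subset_leftPoles`). This
is the passage from a-Browder's theorem to its generalized form.

For the proof of that fact let `S = T - λ` be upper semi-B-Weyl, with `R(S ^ n)` closed and `S_[n]`
upper semi-Weyl. An upper semi-Weyl operator is the sum of an operator that is bounded below and one
of finite rank, and conversely such a sum is upper semi-Weyl (`IsUpperSemiWeyl.exists_eq_add`,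
`IsBoundedBelow.isUpperSemiWeyl_add`). Hence `S_[n] - μ` is upper semi-Weyl for small `μ`, and for
`μ ≠ 0` so is `S - μ`, which has the same kernel and cokernel. No perturbation theory of the index
is needed. If `ker S` meets the range of every power of `S`, then it meets the closed space
`⋂ R(S ^ k)`, which `S` maps onto itself, and a power series of iterated preimages shows that every small `μ`
is an eigenvalue of `S` (`exists_not_injective_shift`). Then a punctured disc about `λ` consists of
eigenvalues of `T` in `Δ_a(T)`, that is, of poles, although no other eigenvalues lie near a pole
(`IsDrazinInvertible.exists_injective_shift`). So `ker S` is disjoint from the range of some power,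
which means that the ascent `p` of `S` is finite. The ranges of high powers of `S` are closed, and
Neumann's lemma (`isClosed_range_of_disjoint_of_isClosed_sup`) carries this down to
`R(S ^ (p + 1))`.
-/

namespace WeylType

open Cardinal Topology

/-! ### Nullity, deficiency and index -/

section Index

/-- A linear map induces a map from `V ⧸ K` to `V ⧸ f K`. If `K` meets the kernel of `f` trivially,
the induced map has the same nullity and the same deficiency as `f`, so that the rank-nullity
theorem for it compares the nullity and the deficiency of `f` with the codimensions of `K` and of
its image. -/
theorem rank_quotient_add_rank_quotient_range {k : Type*} [Field k] {V : Type*} [AddCommGroup V]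
    [Module k V] (f : V →ₗ[k] V) (K : Submodule k V) (h : Disjoint K f.ker) :
    Module.rank k (V ⧸ K) + Module.rank k (V ⧸ f.range) =
      Module.rank k f.ker + Module.rank k (V ⧸ K.map f) := by
  set g : (V ⧸ K) →ₗ[k] (V ⧸ K.map f) := K.mapQ (K.map f) f (Submodule.le_comap_map f K) with hg
  have h1 := g.rank_range_add_rank_ker
  have h2 := g.range.rank_quotient_add_rank
  have hker : Module.rank k g.ker = Module.rank k f.ker := by
    have e1 : g.ker = f.ker.map K.mkQ := by
      rw [hg, Submodule.ker_mapQ, Submodule.comap_map_eq, Submodule.map_sup]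
      simp
    have hinj : Function.Injective (K.mkQ.domRestrict f.ker) := by
      rw [← LinearMap.ker_eq_bot, LinearMap.ker_eq_bot']
      intro x hx
      have hx' : (x : V) ∈ K := by simpa using hx
      exact Subtype.ext (Submodule.disjoint_def.1 h _ hx' x.2)
    have e2 : (K.mkQ.domRestrict f.ker).range = f.ker.map K.mkQ := by
      rw [LinearMap.range_domRestrict]
    rw [e1, ← e2]
    exact (LinearEquiv.ofInjective _ hinj).rank_eq.symm
  have hran : Module.rank k ((V ⧸ K.map f) ⧸ g.range) = Module.rank k (V ⧸ f.range) := by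
    have e1 : g.range = f.range.map (K.map f).mkQ := by
      rw [hg, Submodule.range_mapQ]
    rw [e1]
    exact (Submodule.quotientQuotientEquivQuotient _ _ LinearMap.map_le_range).rank_eq
  rw [hker] at h1
  rw [hran] at h2
  rw [← h1, ← h2]
  abel

variable {E : Type*} [NormedAddCommGroup E] [NormedSpace ℂ E]

theorem nullity_lt_top_iff {S : E →L[ℂ] E} : nullity S < ⊤ ↔ FiniteDimensional ℂ S.ker := by
  rw [nullity, toENat_lt_top, Module.rank_lt_aleph0_iff]

theorem deficiency_lt_top_iff {S : E →L[ℂ] E} :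
    deficiency S < ⊤ ↔ FiniteDimensional ℂ (E ⧸ S.range) := by
  rw [deficiency, toENat_lt_top, Module.rank_lt_aleph0_iff]

theorem nullity_eq_zero_iff {S : E →L[ℂ] E} : nullity S = 0 ↔ Function.Injective S := by
  rw [nullity, toENat_eq_zero, rank_zero_iff, Submodule.subsingleton_iff_eq_bot,
    LinearMap.ker_eq_bot]
  rfl

theorem deficiency_eq_zero_iff {S : E →L[ℂ] E} : deficiency S = 0 ↔ Function.Surjective S := by
  rw [deficiency, toENat_eq_zero, rank_zero_iff, Submodule.Quotient.subsingleton_iff,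
    LinearMap.range_eq_top]
  rfl

theorem index_nonpos_iff {S : E →L[ℂ] E} : index S ≤ 0 ↔ nullity S ≤ deficiency S := by
  rw [index, EReal.sub_nonpos, EReal.coe_ennreal_le_coe_ennreal_iff, ENat.toENNReal_le]

theorem index_eq_zero_iff {S : E →L[ℂ] E} (h : nullity S < ⊤) :
    index S = 0 ↔ nullity S = deficiency S := by
  have h1 : ((nullity S : ENNReal) : EReal) ≠ ⊤ := by
    simpa using h.ne
  rw [index]
  constructor
  · intro h0
    have := (EReal.sub_nonpos).1 h0.le
    have h2 := (EReal.sub_nonneg (Or.inl h1) (Or.inl (by simp))).1 h0.ge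
    have := le_antisymm this h2
    simpa using this
  · intro h0
    rw [← h0]
    exact EReal.sub_self h1 (by simp)

end Index

/-! ### Closed ranges -/

section ClosedRange

variable {E F : Type*} [NormedAddCommGroup E] [NormedSpace ℂ E] [CompleteSpace E]
  [NormedAddCommGroup F] [NormedSpace ℂ F] [CompleteSpace F]

/-- By the open mapping theorem the corestriction of `f` to its range is a quotient map, so that
the image of `N` is closed in the range as soon as its preimage `N ⊔ ker f` is. -/
theorem isClosed_map_of_isClosed_sup_ker (f : E →L[ℂ] F) (hf : IsClosed (f.range : Set F))
    (N : Submodule ℂ E) (hN : IsClosed ((N ⊔ f.ker : Submodule ℂ E) : Set E)) :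
    IsClosed ((N.map (f : E →ₗ[ℂ] F) : Submodule ℂ F) : Set F) := by
  have : CompleteSpace f.range := hf.completeSpace_coe
  have hq : IsQuotientMap f.rangeRestrict :=
    f.rangeRestrict.isQuotientMap (LinearMap.surjective_rangeRestrict _)
  have h1 : IsClosed {y : f.range | (y : F) ∈ N.map (f : E →ₗ[ℂ] F)} := by
    rw [← hq.isClosed_preimage]
    convert hN using 1
    ext x
    rw [← Submodule.comap_map_eq]
    rfl
  convert hf.isClosedEmbedding_subtypeVal.isClosedMap _ h1 using 1
  ext y
  constructor
  · rintro ⟨x, hx, rfl⟩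
    exact ⟨⟨f x, x, rfl⟩, ⟨x, hx, rfl⟩, rfl⟩
  · rintro ⟨y, hy, rfl⟩
    exact hy

/-- **Neumann's lemma**: if the range of `f` and a closed subspace `G` have trivial intersection
and closed sum, then the range is closed. The addition map `E × G → range f ⊔ G` is a quotient map,
and the preimage of the range of `f` under it is `E × {0}`. -/
theorem isClosed_range_of_disjoint_of_isClosed_sup (f : E →L[ℂ] F) (G : Submodule ℂ F)
    (hG : IsClosed (G : Set F)) (hd : Disjoint f.range G)
    (hs : IsClosed ((f.range ⊔ G : Submodule ℂ F) : Set F)) : IsClosed (f.range : Set F) := by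
  have : CompleteSpace G := hG.completeSpace_coe
  set c : E × G →L[ℂ] F := f.coprod G.subtypeL with hc
  have hr : c.range = f.range ⊔ G := by
    rw [hc, ContinuousLinearMap.coe_coprod, LinearMap.range_coprod]
    simp
  have key : (f.range : Submodule ℂ F) =
      (((⊤ : Submodule ℂ E).prod (⊥ : Submodule ℂ G)).map (c : E × G →ₗ[ℂ] F)) := by
    rw [hc, ContinuousLinearMap.coe_coprod, LinearMap.coprod_map_prod, Submodule.map_bot,
      sup_bot_eq, Submodule.map_top]
  rw [key]
  refine isClosed_map_of_isClosed_sup_ker c (by rw [hr]; exact hs) _ ?_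
  have hk : c.ker ≤ (⊤ : Submodule ℂ E).prod (⊥ : Submodule ℂ G) := by
    rintro ⟨x, g⟩ hx
    have hx' : f x + g = 0 := by simpa [hc] using hx
    have hg : (g : F) = 0 := by
      refine Submodule.disjoint_def.1 hd _ ⟨-x, ?_⟩ g.2
      have := eq_neg_of_add_eq_zero_right hx'
      simp [this]
    simpa using hg
  rw [sup_eq_left.2 hk]
  exact isClosed_univ.prod isClosed_singleton

theorem isBoundedBelow_iff (S : E →L[ℂ] E) :
    IsBoundedBelow S ↔ Function.Injective S ∧ IsClosed (S.range : Set E) := by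
  constructor
  · rintro ⟨c, hc, h⟩
    have ha : AntilipschitzWith (Real.toNNReal c⁻¹) S := by
      refine AddMonoidHomClass.antilipschitz_of_bound S fun x => ?_
      rw [Real.coe_toNNReal _ (by positivity), inv_mul_eq_div, le_div_iff₀ hc, mul_comm]
      exact h x
    exact ⟨ha.injective, ha.isClosed_range S.uniformContinuous⟩
  · rintro ⟨hi, hcl⟩
    obtain ⟨K, hK⟩ := S.antilipschitz_of_injective_of_isClosed_range hi hcl
    refine ⟨((K : ℝ) + 1)⁻¹, by positivity, fun x => ?_⟩
    have := hK.le_mul_dist x 0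
    simp only [dist_zero_right, map_zero] at this
    rw [inv_mul_le_iff₀ (by positivity)]
    nlinarith [norm_nonneg (S x)]

end ClosedRange

/-! ### Upper semi-Weyl operators as finite rank perturbations -/

theorem IsBoundedBelow.exists_isBoundedBelow_shift {E : Type*} [NormedAddCommGroup E]
    [NormedSpace ℂ E] {S : E →L[ℂ] E} (h : IsBoundedBelow S) :
    ∃ ε > 0, ∀ μ : ℂ, ‖μ‖ < ε → IsBoundedBelow (shift S μ) := by
  obtain ⟨c, hc, h⟩ := h
  refine ⟨c, hc, fun μ hμ => ⟨c - ‖μ‖, by linarith, fun x => ?_⟩⟩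
  have : ‖S x‖ - ‖μ • x‖ ≤ ‖S x - μ • x‖ := norm_sub_norm_le _ _
  rw [norm_smul] at this
  have h' := h x
  simp only [shift, sub_apply, smul_apply,
    ContinuousLinearMap.id_apply]
  linarith

section Perturbation

variable {E : Type*} [NormedAddCommGroup E] [NormedSpace ℂ E] [CompleteSpace E]

/-- An injection of the kernel into a complement of the range, precomposed with a projection onto
the kernel, is a finite rank operator that makes the sum with `S` injective. -/
theorem IsUpperSemiWeyl.exists_eq_add {S : E →L[ℂ] E} (h : IsUpperSemiWeyl S) :
    ∃ B F : E →L[ℂ] E, IsBoundedBelow B ∧ FiniteDimensional ℂ F.range ∧ S = B + F := by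
  obtain ⟨⟨hk, hcl⟩, hi⟩ := h
  have : FiniteDimensional ℂ S.ker := nullity_lt_top_iff.1 hk
  rw [index_nonpos_iff, nullity, deficiency,
    toENat_le_iff_of_le_aleph0 (toENat_lt_top.1 hk).le, rank_le_iff_exists_linearMap] at hi
  obtain ⟨j, hj⟩ := hi
  obtain ⟨s, hs⟩ := S.range.mkQ.exists_rightInverse_of_surjective (by simp)
  obtain ⟨P, hP⟩ := Submodule.ClosedComplemented.of_finiteDimensional S.ker
  set J : S.ker →ₗ[ℂ] E := s ∘ₗ j with hJ
  have hJ0 : ∀ z : S.ker, J z ∈ S.range → z = 0 := by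
    intro z hz
    have h1 : S.range.mkQ (J z) = j z := LinearMap.congr_fun hs (j z)
    have h2 : S.range.mkQ (J z) = 0 := by simpa using hz
    exact hj (by rw [← h1, h2, map_zero])
  set F : E →L[ℂ] E := J.toContinuousLinearMap.comp P with hF
  have hFx : ∀ x, F x = J (P x) := fun x => rfl
  have hFr : FiniteDimensional ℂ F.range := by
    refine Submodule.finiteDimensional_of_le (S₂ := J.range) ?_
    rintro _ ⟨x, rfl⟩
    exact ⟨P x, rfl⟩
  have hB : IsBoundedBelow (S + F) := by
    rw [isBoundedBelow_iff]
    constructor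
    · rw [injective_iff_map_eq_zero]
      intro x hx
      rw [add_apply, hFx] at hx
      have hPx : P x = 0 := hJ0 _ ⟨-x, by
        have := eq_neg_of_add_eq_zero_right hx
        simp [this]⟩
      rw [hPx, map_zero, add_zero] at hx
      have := hP ⟨x, hx⟩
      rw [hPx] at this
      simpa using (congrArg Subtype.val this).symm
    · have hr : (S + F).range = S.range ⊔ F.range := by
        apply le_antisymm
        · rintro _ ⟨x, rfl⟩
          exact Submodule.add_mem_sup ⟨x, rfl⟩ ⟨x, rfl⟩
        · refine sup_le ?_ ?_
          · rintro _ ⟨x, rfl⟩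
            -- `x - P x` has the same image under `S` and is annihilated by `P`.
            refine ⟨x - P x, ?_⟩
            have h1 : P (x - P x) = 0 := by rw [map_sub, hP, sub_self]
            have h2 : S (P x) = 0 := (P x).2
            simp [hFx, h1, h2]
          · rintro _ ⟨x, rfl⟩
            refine ⟨P x, ?_⟩
            simp [hFx, hP]
      rw [hr]
      exact Submodule.isClosed_sup_finiteDimensional _ _ hcl
  refine ⟨S + F, -F, hB, ?_, by simp⟩
  have : (-F).range = F.range := by
    rw [ContinuousLinearMap.toLinearMap_neg, LinearMap.range_neg]
  rwa [this]

/-- On the kernel `K` of `F`, which has finite codimension `d`, the operator `B + F` agrees with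
`B`. Counting dimensions modulo `K` and modulo `B K` shows that `α + codim (B K) = β + d`, and
`codim (B K) ≥ d` because `B` is injective. -/
theorem IsBoundedBelow.isUpperSemiWeyl_add {B F : E →L[ℂ] E} (hB : IsBoundedBelow B)
    (hF : FiniteDimensional ℂ F.range) : IsUpperSemiWeyl (B + F) := by
  rw [isBoundedBelow_iff] at hB
  obtain ⟨hinj, hcl⟩ := hB
  have hd : FiniteDimensional ℂ (E ⧸ F.ker) :=
    (F : E →ₗ[ℂ] E).quotKerEquivRange.symm.finiteDimensional
  have hmap : F.ker.map ((B + F : E →L[ℂ] E) : E →ₗ[ℂ] E) = F.ker.map (B : E →ₗ[ℂ] E) := by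
    refine SetLike.coe_injective (Set.image_congr fun x hx => ?_)
    have hx' : F x = 0 := hx
    change B x + F x = B x
    rw [hx', add_zero]
  have hBker : B.ker = ⊥ := LinearMap.ker_eq_bot.2 hinj
  have hdisj : Disjoint F.ker (B + F).ker := by
    rw [Submodule.disjoint_def]
    intro x hx hx2
    have h1 : F x = 0 := hx
    have h2 : B x + F x = 0 := hx2
    rw [h1, add_zero] at h2
    exact hinj (by rw [h2, map_zero])
  have hBK : IsClosed ((F.ker.map (B : E →ₗ[ℂ] E) : Submodule ℂ E) : Set E) := by
    refine isClosed_map_of_isClosed_sup_ker B hcl _ ?_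
    rw [hBker, sup_bot_eq]
    exact F.isClosed_ker
  have hker : FiniteDimensional ℂ (B + F).ker := by
    have hinj2 : Function.Injective (F.ker.mkQ.domRestrict (B + F).ker) := by
      rw [← LinearMap.ker_eq_bot, LinearMap.ker_eq_bot']
      intro x hx
      have hx' : (x : E) ∈ F.ker := by simpa using hx
      exact Subtype.ext (Submodule.disjoint_def.1 hdisj _ hx' x.2)
    exact FiniteDimensional.of_injective _ hinj2
  refine ⟨⟨nullity_lt_top_iff.2 hker, ?_⟩, ?_⟩
  · have : F.ker.CoFG := hd
    refine LinearMap.isClosed_range_of_isClosed_map_of_finiteDimensional_quotient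
      (s := F.ker) ?_
    rw [hmap]
    exact hBK
  · rw [index_nonpos_iff]
    have e1 := congrArg toENat
      (rank_quotient_add_rank_quotient_range ((B + F : E →L[ℂ] E) : E →ₗ[ℂ] E) F.ker hdisj)
    have e2 := congrArg toENat
      (rank_quotient_add_rank_quotient_range (B : E →ₗ[ℂ] E) F.ker (by rw [hBker]; simp))
    rw [map_add, map_add, hmap] at e1
    rw [map_add, map_add, hBker, rank_bot, map_zero, zero_add] at e2
    rw [← e2] at e1
    have hfin : toENat (Module.rank ℂ (E ⧸ F.ker)) ≠ ⊤ :=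
      (toENat_lt_top.2 (Module.rank_lt_aleph0_iff.2 hd)).ne
    have e3 : toENat (Module.rank ℂ (E ⧸ F.ker)) + nullity (B + F) ≤
        toENat (Module.rank ℂ (E ⧸ F.ker)) + deficiency (B + F) := by
      rw [deficiency, e1, nullity, add_left_comm]
      gcongr
      exact le_self_add
    exact (ENat.add_le_add_iff_left hfin).1 e3

/-- Being upper semi-Weyl is stable under small translations: in `S = B + F` with `B` bounded below
and `F` of finite rank, only the summand `B` is translated. -/
theorem IsUpperSemiWeyl.exists_isUpperSemiWeyl_shift {S : E →L[ℂ] E} (h : IsUpperSemiWeyl S) :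
    ∃ ε > 0, ∀ μ : ℂ, ‖μ‖ < ε → IsUpperSemiWeyl (shift S μ) := by
  obtain ⟨B, F, hB, hF, rfl⟩ := h.exists_eq_add
  obtain ⟨ε, hε, hb⟩ := hB.exists_isBoundedBelow_shift
  refine ⟨ε, hε, fun μ hμ => ?_⟩
  have : shift (B + F) μ = shift B μ + F := by
    simp only [shift]
    abel
  rw [this]
  exact (hb μ hμ).isUpperSemiWeyl_add hF

end Perturbation

/-! ### Eigenvectors of surjective operators -/

/-- If `S` is onto and `S x₀ = 0`, then a chain of preimages `S (x (k + 1)) = x k` of geometric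
growth gives eigenvectors `∑ μ ^ k • x k` for all small `μ`. -/
theorem exists_eigenvector_of_surjective {E : Type*} [NormedAddCommGroup E] [NormedSpace ℂ E]
    [CompleteSpace E] (S : E →L[ℂ] E) (hS : Function.Surjective S) {x₀ : E} (hx₀ : x₀ ≠ 0)
    (h0 : S x₀ = 0) : ∃ ε > 0, ∀ μ : ℂ, ‖μ‖ < ε → ∃ y ≠ 0, S y = μ • y := by
  obtain ⟨C, hC, hpre⟩ := S.exists_preimage_norm_le hS
  choose g hg hgn using hpre
  refine ⟨(2 * C)⁻¹, by positivity, fun μ hμ => ?_⟩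
  set x : ℕ → E := fun k => g^[k] x₀ with hx
  have hxs : ∀ k, x (k + 1) = g (x k) := fun k => Function.iterate_succ_apply' g k x₀
  have hr : ‖μ‖ * C < 1 / 2 := by
    have := mul_lt_mul_of_pos_right hμ hC
    rwa [mul_inv, mul_assoc, inv_mul_cancel₀ hC.ne', mul_one, ← one_div] at this
  have hxn : ∀ k, ‖μ ^ k • x k‖ ≤ ‖x₀‖ * (‖μ‖ * C) ^ k := by
    intro k
    rw [norm_smul, norm_pow]
    induction k with
    | zero => simp [hx]
    | succ k ih =>
      rw [hxs]
      calc ‖μ‖ ^ (k + 1) * ‖g (x k)‖ ≤ ‖μ‖ ^ (k + 1) * (C * ‖x k‖) := by gcongr; exact hgn _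
        _ = (‖μ‖ * C) * (‖μ‖ ^ k * ‖x k‖) := by ring
        _ ≤ (‖μ‖ * C) * (‖x₀‖ * (‖μ‖ * C) ^ k) := by gcongr
        _ = _ := by ring
  have hgeo := (hasSum_geometric_of_lt_one (r := ‖μ‖ * C) (by positivity) (by linarith)).mul_left
    ‖x₀‖
  have hsum : Summable fun k => μ ^ k • x k := Summable.of_norm_bounded hgeo.summable hxn
  have hsum1 : Summable fun k => μ ^ k • x (k + 1) := by
    by_cases hμ0 : μ = 0
    · refine summable_of_ne_finset_zero (s := {0}) fun k hk => ?_
      simp at hk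
      simp [hμ0, hk]
    · have := ((summable_nat_add_iff 1).2 hsum).const_smul μ⁻¹
      refine this.congr fun k => ?_
      rw [smul_smul, pow_succ', inv_mul_cancel_left₀ hμ0]
  have hsplit : ∑' k, μ ^ k • x k = x₀ + μ • ∑' k, μ ^ k • x (k + 1) := by
    rw [hsum.tsum_eq_zero_add, ← tsum_const_smul'' μ]
    simp [hx, smul_smul, pow_succ']
  have hSy1 : S (∑' k, μ ^ k • x (k + 1)) = ∑' k, μ ^ k • x k := by
    rw [S.map_tsum hsum1]
    refine tsum_congr fun k => ?_
    rw [map_smul, hxs, hg]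
  refine ⟨∑' k, μ ^ k • x k, ?_, ?_⟩
  · intro hy
    have h1 := hsum.tsum_eq_zero_add
    rw [hy] at h1
    have h2 : ‖∑' k, μ ^ (k + 1) • x (k + 1)‖ ≤ ‖x₀‖ * (‖μ‖ * C) * (1 - ‖μ‖ * C)⁻¹ := by
      refine tsum_of_norm_bounded ((hasSum_geometric_of_lt_one (r := ‖μ‖ * C) (by positivity)
        (by linarith)).mul_left (‖x₀‖ * (‖μ‖ * C))) fun k => ?_
      refine (hxn (k + 1)).trans_eq ?_
      ring
    have h3 : ∑' k, μ ^ (k + 1) • x (k + 1) = -x₀ := by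
      have : x 0 = x₀ := rfl
      simp only [pow_zero, one_smul, this] at h1
      exact eq_neg_of_add_eq_zero_right h1.symm
    rw [h3, norm_neg, ← div_eq_mul_inv, le_div_iff₀ (by linarith)] at h2
    have := norm_pos_iff.2 hx₀
    nlinarith
  · conv_lhs => rw [hsplit]
    rw [map_add, map_smul, h0, zero_add, hSy1]

/-! ### Powers, ascent and descent -/

section Powers

variable {E : Type*} [NormedAddCommGroup E] [NormedSpace ℂ E]

theorem range_pow_antitone (S : E →L[ℂ] E) : Antitone fun n : ℕ => (S ^ n).range := by
  refine antitone_nat_of_succ_le fun n => ?_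
  rintro _ ⟨x, rfl⟩
  exact ⟨S x, by rw [pow_succ]; rfl⟩

theorem pow_add_apply (S : E →L[ℂ] E) (m n : ℕ) (x : E) :
    (S ^ (m + n)) x = (S ^ m) ((S ^ n) x) := by
  rw [pow_add]
  rfl

theorem pow_succ_apply (S : E →L[ℂ] E) (n : ℕ) (x : E) : (S ^ (n + 1)) x = (S ^ n) (S x) := by
  rw [pow_succ]
  rfl

theorem pow_succ_apply' (S : E →L[ℂ] E) (n : ℕ) (x : E) : (S ^ (n + 1)) x = S ((S ^ n) x) := by
  rw [pow_succ']
  rfl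

theorem range_pow_succ (S : E →L[ℂ] E) (n : ℕ) :
    (S ^ (n + 1)).range = (S ^ n).range.map (S : E →ₗ[ℂ] E) := by
  ext y
  constructor
  · rintro ⟨x, rfl⟩
    exact ⟨(S ^ n) x, ⟨x, rfl⟩, (pow_succ_apply' S n x).symm⟩
  · rintro ⟨_, ⟨x, rfl⟩, rfl⟩
    exact ⟨x, pow_succ_apply' S n x⟩

theorem ker_pow_eq_of_le {S : E →L[ℂ] E} {p n : ℕ} (h : (S ^ p).ker = (S ^ (p + 1)).ker)
    (hn : p ≤ n) : (S ^ n).ker = (S ^ p).ker := by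
  induction n, hn using Nat.le_induction with
  | base => rfl
  | succ n hn ih =>
    ext x
    change (S ^ (n + 1)) x = 0 ↔ _
    rw [pow_succ_apply]
    change S x ∈ (S ^ n).ker ↔ _
    rw [ih]
    conv_rhs => rw [h]
    change (S ^ p) (S x) = 0 ↔ (S ^ (p + 1)) x = 0
    rw [pow_succ_apply]

theorem range_pow_eq_of_le {S : E →L[ℂ] E} {q n : ℕ} (h : (S ^ q).range = (S ^ (q + 1)).range)
    (hn : q ≤ n) : (S ^ n).range = (S ^ q).range := by
  induction n, hn using Nat.le_induction with
  | base => rfl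
  | succ n hn ih => rw [range_pow_succ, ih, ← range_pow_succ, h]

theorem disjoint_ker_range_pow_iff {S : E →L[ℂ] E} {n : ℕ} :
    Disjoint S.ker (S ^ n).range ↔ (S ^ n).ker = (S ^ (n + 1)).ker := by
  rw [Submodule.disjoint_def]
  constructor
  · intro h
    ext x
    change (S ^ n) x = 0 ↔ (S ^ (n + 1)) x = 0
    rw [pow_succ_apply']
    exact ⟨fun hx => by rw [hx, map_zero], fun hx => h _ hx ⟨x, rfl⟩⟩
  · rintro h _ hx ⟨y, rfl⟩
    change y ∈ (S ^ n).ker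
    rw [h]
    change (S ^ (n + 1)) y = 0
    rw [pow_succ_apply']
    exact hx

theorem ascent_le {S : E →L[ℂ] E} {n : ℕ} (h : (S ^ n).ker = (S ^ (n + 1)).ker) :
    ascent S ≤ n :=
  iInf₂_le n h

/-- A finite ascent is attained. -/
theorem exists_ascent_eq {S : E →L[ℂ] E} (h : ascent S < ⊤) :
    ∃ p : ℕ, ascent S = p ∧ (S ^ p).ker = (S ^ (p + 1)).ker := by
  have hex : ∃ n, (S ^ n).ker = (S ^ (n + 1)).ker := by
    by_contra! hne
    simp only [ascent, hne, iInf_false, iInf_top, lt_self_iff_false] at h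
  classical
  refine ⟨Nat.find hex, le_antisymm (ascent_le (Nat.find_spec hex)) ?_, Nat.find_spec hex⟩
  exact le_iInf₂ fun n hn => by exact_mod_cast Nat.find_min' hex hn

theorem exists_range_eq_of_descent_lt_top {S : E →L[ℂ] E} (h : descent S < ⊤) :
    ∃ q : ℕ, (S ^ q).range = (S ^ (q + 1)).range := by
  by_contra! hne
  simp only [descent, hne, iInf_false, iInf_top, lt_self_iff_false] at h

theorem ker_pow_zero_eq_of_injective {S : E →L[ℂ] E} (h : Function.Injective S) :
    (S ^ 0).ker = (S ^ 1).ker := by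
  rw [← disjoint_ker_range_pow_iff, LinearMap.ker_eq_bot.2 h]
  exact disjoint_bot_left

theorem map_subtype_range_restrictRangePow (S : E →L[ℂ] E) (n : ℕ) :
    (restrictRangePow S n).range.map (S ^ n).range.subtype = (S ^ (n + 1)).range := by
  rw [range_pow_succ]
  ext y
  constructor
  · rintro ⟨_, ⟨x, rfl⟩, rfl⟩
    exact ⟨x, x.2, rfl⟩
  · rintro ⟨x, hx, rfl⟩
    exact ⟨restrictRangePow S n ⟨x, hx⟩, ⟨_, rfl⟩, rfl⟩

theorem restrictRangePow_injective_iff {S : E →L[ℂ] E} {n : ℕ} :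
    Function.Injective (restrictRangePow S n) ↔ (S ^ n).ker = (S ^ (n + 1)).ker := by
  rw [← disjoint_ker_range_pow_iff, Submodule.disjoint_def, injective_iff_map_eq_zero]
  constructor
  · intro h x hx hx'
    exact congrArg Subtype.val (h ⟨x, hx'⟩ (Subtype.ext hx))
  · intro h x hx
    exact Subtype.ext (h x (congrArg Subtype.val hx) x.2)

theorem isClosed_range_restrictRangePow_iff {S : E →L[ℂ] E} {n : ℕ}
    (h : IsClosed ((S ^ n).range : Set E)) :
    IsClosed ((restrictRangePow S n).range : Set (S ^ n).range) ↔
      IsClosed ((S ^ (n + 1)).range : Set E) := by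
  rw [← map_subtype_range_restrictRangePow]
  exact h.isClosedEmbedding_subtypeVal.isClosed_iff_image_isClosed

theorem pow_apply_of_eq_smul {S : E →L[ℂ] E} {x : E} {μ : ℂ} (h : S x = μ • x) (n : ℕ) :
    (S ^ n) x = μ ^ n • x := by
  induction n with
  | zero => simp
  | succ n ih => rw [pow_succ_apply, h, map_smul, ih, smul_smul, pow_succ']

/-- Eigenvectors for nonzero eigenvalues lie in the range of every power. -/
theorem mem_range_pow_of_eq_smul {S : E →L[ℂ] E} {x : E} {μ : ℂ} (hμ : μ ≠ 0) (h : S x = μ • x)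
    (n : ℕ) : x ∈ (S ^ n).range := by
  refine ⟨(μ ^ n)⁻¹ • x, ?_⟩
  change (S ^ n) _ = x
  rw [map_smul, pow_apply_of_eq_smul h, smul_smul, inv_mul_cancel₀ (pow_ne_zero n hμ), one_smul]

theorem shift_apply (S : E →L[ℂ] E) (μ : ℂ) (x : E) : shift S μ x = S x - μ • x := rfl

theorem shift_shift (S : E →L[ℂ] E) (μ ν : ℂ) : shift (shift S μ) ν = shift S (μ + ν) := by
  simp only [shift, add_smul]
  abel

end Powers

/-! ### Translates of an operator and of its restriction to the range of a power -/

section Restriction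

variable {E : Type*} [NormedAddCommGroup E] [NormedSpace ℂ E]

/-- The difference `S ^ n y - μ ^ n y` is a multiple of `S - μ`. -/
theorem pow_sub_smul_mem_range_shift (S : E →L[ℂ] E) (μ : ℂ) (n : ℕ) (y : E) :
    (S ^ n) y - μ ^ n • y ∈ (shift S μ).range := by
  induction n with
  | zero => simp
  | succ n ih =>
    have h1 : (S ^ (n + 1)) y - μ ^ (n + 1) • y =
        shift S μ ((S ^ n) y) + μ • ((S ^ n) y - μ ^ n • y) := by
      rw [shift_apply, pow_succ_apply', smul_sub, smul_smul, ← pow_succ']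
      abel
    rw [h1]
    exact add_mem ⟨_, rfl⟩ (Submodule.smul_mem _ _ ih)

theorem mem_range_pow_of_shift_mem {S : E →L[ℂ] E} {μ : ℂ} (hμ : μ ≠ 0) {n : ℕ} {x : E}
    (h : shift S μ x ∈ (S ^ n).range) : x ∈ (S ^ n).range := by
  -- Each step pushes `x` into the range of the next power.
  have key : ∀ k ≤ n, x ∈ (S ^ k).range := by
    intro k
    induction k with
    | zero => exact fun _ => ⟨x, rfl⟩
    | succ k ih =>
      intro hk
      have h1 : x = μ⁻¹ • (S x - shift S μ x) := by
        rw [shift_apply, sub_sub_cancel, smul_smul, inv_mul_cancel₀ hμ, one_smul]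
      rw [h1]
      refine Submodule.smul_mem _ _ (sub_mem ?_ (range_pow_antitone S hk h))
      rw [range_pow_succ]
      exact ⟨x, ih (by omega), rfl⟩
  exact key n le_rfl

theorem mem_range_shift_iff {S : E →L[ℂ] E} {μ : ℂ} (hμ : μ ≠ 0) (n : ℕ) (y : (S ^ n).range) :
    (y : E) ∈ (shift S μ).range ↔ y ∈ (shift (restrictRangePow S n) μ).range := by
  constructor
  · rintro ⟨x, hx⟩
    have hx' : shift S μ x = y := hx
    have : x ∈ (S ^ n).range := mem_range_pow_of_shift_mem hμ (by rw [hx']; exact y.2)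
    exact ⟨⟨x, this⟩, Subtype.ext hx⟩
  · rintro ⟨x, rfl⟩
    exact ⟨x, rfl⟩

/-- Modulo the range of `S - μ`, the operator `S ^ n` acts as multiplication by `μ ^ n`. -/
theorem mem_range_shift_iff_pow {S : E →L[ℂ] E} {μ : ℂ} (hμ : μ ≠ 0) (n : ℕ) (y : E) :
    y ∈ (shift S μ).range ↔
      (⟨(S ^ n) y, y, rfl⟩ : (S ^ n).range) ∈ (shift (restrictRangePow S n) μ).range := by
  rw [← mem_range_shift_iff hμ]
  have h := pow_sub_smul_mem_range_shift S μ n y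
  constructor
  · intro hy
    have := add_mem h (Submodule.smul_mem _ (μ ^ n) hy)
    rwa [sub_add_cancel] at this
  · intro hy
    have := sub_mem hy h
    rw [sub_sub_cancel] at this
    rwa [Submodule.smul_mem_iff _ (pow_ne_zero n hμ)] at this

theorem nullity_shift_restrictRangePow (S : E →L[ℂ] E) {μ : ℂ} (hμ : μ ≠ 0) (n : ℕ) :
    nullity (shift (restrictRangePow S n) μ) = nullity (shift S μ) := by
  have h : (shift (restrictRangePow S n) μ).ker.map (S ^ n).range.subtype = (shift S μ).ker := by
    ext x
    constructor
    · rintro ⟨y, hy, rfl⟩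
      exact congrArg Subtype.val hy
    · intro hx
      have hx' : S x = μ • x := sub_eq_zero.1 hx
      exact ⟨⟨x, mem_range_pow_of_eq_smul hμ hx' n⟩, Subtype.ext hx, rfl⟩
  rw [nullity, nullity, ← h]
  exact congrArg _ (Submodule.equivMapOfInjective _ Subtype.val_injective _).rank_eq

theorem deficiency_shift_restrictRangePow (S : E →L[ℂ] E) {μ : ℂ} (hμ : μ ≠ 0) (n : ℕ) :
    deficiency (shift (restrictRangePow S n) μ) = deficiency (shift S μ) := by
  set f : (S ^ n).range →ₗ[ℂ] E ⧸ (shift S μ).range :=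
    (shift S μ).range.mkQ ∘ₗ (S ^ n).range.subtype with hf
  have hker : f.ker = (shift (restrictRangePow S n) μ).range := by
    ext y
    rw [← mem_range_shift_iff hμ]
    simp [hf]
  have hsurj : Function.Surjective f := by
    intro z
    obtain ⟨y, rfl⟩ := Submodule.mkQ_surjective _ z
    refine ⟨(μ ^ n)⁻¹ • ⟨(S ^ n) y, y, rfl⟩, ?_⟩
    rw [map_smul, inv_smul_eq_iff₀ (pow_ne_zero n hμ), ← map_smul, ← sub_eq_zero]
    simp only [hf, LinearMap.comp_apply]
    rw [← map_sub]
    exact (Submodule.Quotient.mk_eq_zero _).2 (pow_sub_smul_mem_range_shift S μ n y)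
  rw [deficiency, deficiency, ← hker]
  exact congrArg _ (f.quotKerEquivOfSurjective hsurj).rank_eq

/-- For `μ ≠ 0` the operators `S - μ` and `S_[n] - μ` have the same nullity and deficiency, and
the range of the former is the preimage under `S ^ n` of the range of the latter. -/
theorem isUpperSemiWeyl_shift_of_restrictRangePow {S : E →L[ℂ] E} {μ : ℂ} (hμ : μ ≠ 0) {n : ℕ}
    (h : IsUpperSemiWeyl (shift (restrictRangePow S n) μ)) : IsUpperSemiWeyl (shift S μ) := by
  obtain ⟨⟨h1, h2⟩, h3⟩ := h
  rw [index_nonpos_iff] at h3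
  rw [nullity_shift_restrictRangePow S hμ] at h1 h3
  rw [deficiency_shift_restrictRangePow S hμ] at h3
  refine ⟨⟨h1, ?_⟩, index_nonpos_iff.2 h3⟩
  have : ((shift S μ).range : Set E) =
      (S ^ n).rangeRestrict ⁻¹' ((shift (restrictRangePow S n) μ).range : Set (S ^ n).range) := by
    ext y
    exact mem_range_shift_iff_pow hμ n y
  rw [this]
  exact h2.preimage (S ^ n).rangeRestrict.continuous

/-- The case `n = 0`, where `S_[0]` is a copy of `S`. -/
theorem IsUpperSemiWeyl.isUpperSemiBWeyl {S : E →L[ℂ] E} (h : IsUpperSemiWeyl S) :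
    IsUpperSemiBWeyl S := by
  have htop : (S ^ 0).range = ⊤ := LinearMap.range_eq_top.2 fun x => ⟨x, rfl⟩
  have hcl : IsClosed ((S ^ 0).range : Set E) := by rw [htop]; exact isClosed_univ
  have hnull : nullity (restrictRangePow S 0) = nullity S := by
    have : (restrictRangePow S 0).ker.map (S ^ 0).range.subtype = S.ker := by
      ext x
      constructor
      · rintro ⟨y, hy, rfl⟩
        exact congrArg Subtype.val hy
      · intro hx
        exact ⟨⟨x, x, rfl⟩, Subtype.ext hx, rfl⟩
    rw [nullity, nullity, ← this]
    exact congrArg _ (Submodule.equivMapOfInjective _ Subtype.val_injective _).rank_eq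
  have hdef : deficiency (restrictRangePow S 0) = deficiency S := by
    refine congrArg _ (LinearEquiv.rank_eq (Submodule.Quotient.equiv _ _
      ((LinearEquiv.ofEq _ _ htop).trans Submodule.topEquiv) ?_))
    have := map_subtype_range_restrictRangePow S 0
    rw [zero_add, pow_one] at this
    exact this
  obtain ⟨⟨h1, h2⟩, h3⟩ := h
  rw [index_nonpos_iff] at h3
  refine ⟨0, hcl, ⟨by rwa [hnull], ?_⟩, ?_⟩
  · rw [isClosed_range_restrictRangePow_iff hcl, zero_add, pow_one]
    exact h2
  · rwa [index_nonpos_iff, hnull, hdef]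

end Restriction

/-! ### Drazin invertible and left Drazin invertible operators -/

section Drazin

variable {E : Type*} [NormedAddCommGroup E] [NormedSpace ℂ E]

theorem IsDrazinInvertible.exists_isCompl {S : E →L[ℂ] E} (h : IsDrazinInvertible S) :
    ∃ n : ℕ, (S ^ n).ker = (S ^ (n + 1)).ker ∧ (S ^ n).range = (S ^ (n + 1)).range ∧
      IsCompl (S ^ n).ker (S ^ n).range := by
  obtain ⟨p, -, hp⟩ := exists_ascent_eq h.1
  obtain ⟨q, hq⟩ := exists_range_eq_of_descent_lt_top h.2
  set n := max p q with hn
  have hpn : p ≤ n := le_max_left p q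
  have hqn : q ≤ n := le_max_right p q
  have hk : ∀ m ≥ n, (S ^ m).ker = (S ^ n).ker := fun m hm => by
    rw [ker_pow_eq_of_le hp (hpn.trans hm), ker_pow_eq_of_le hp hpn]
  have hr : ∀ m ≥ n, (S ^ m).range = (S ^ n).range := fun m hm => by
    rw [range_pow_eq_of_le hq (hqn.trans hm), range_pow_eq_of_le hq hqn]
  refine ⟨n, (hk _ (by omega)).symm, (hr _ (by omega)).symm, ?_, ?_⟩
  · rw [Submodule.disjoint_def]
    rintro _ hx ⟨y, rfl⟩
    have : y ∈ (S ^ (n + n)).ker := by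
      change (S ^ (n + n)) y = 0
      rw [pow_add_apply]
      exact hx
    rw [hk _ (by omega)] at this
    exact this
  · rw [codisjoint_iff, eq_top_iff]
    intro x _
    have : (S ^ n) x ∈ (S ^ (n + n)).range := by
      rw [hr _ (by omega)]
      exact ⟨x, rfl⟩
    obtain ⟨y, hy⟩ := this
    have hy' : (S ^ n) ((S ^ n) y) = (S ^ n) x := by rw [← pow_add_apply]; exact hy
    rw [← sub_add_cancel x ((S ^ n) y)]
    refine Submodule.add_mem_sup ?_ ⟨y, rfl⟩
    change (S ^ n) (x - (S ^ n) y) = 0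
    rw [map_sub, hy', sub_self]

theorem IsDrazinInvertible.surjective_of_injective {S : E →L[ℂ] E} (h : IsDrazinInvertible S)
    (hS : Function.Injective S) : Function.Surjective S := by
  obtain ⟨q, hq⟩ := exists_range_eq_of_descent_lt_top h.2
  have hSq : Function.Injective (S ^ q) := by
    have := ker_pow_eq_of_le (ker_pow_zero_eq_of_injective hS) (Nat.zero_le q)
    refine LinearMap.ker_eq_bot.1 (this.trans ?_)
    exact LinearMap.ker_eq_bot.2 fun _ _ h => h
  intro x
  have : (S ^ q) x ∈ (S ^ (q + 1)).range := by
    rw [← hq]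
    exact ⟨x, rfl⟩
  obtain ⟨y, hy⟩ := this
  exact ⟨y, hSq (by rw [← pow_succ_apply]; exact hy)⟩

theorem finiteDimensional_ker_pow {S : E →L[ℂ] E} (h : FiniteDimensional ℂ S.ker) (n : ℕ) :
    FiniteDimensional ℂ (S ^ n).ker := by
  induction n with
  | zero =>
    have : (S ^ 0).ker = ⊥ := LinearMap.ker_eq_bot.2 fun _ _ h => h
    rw [this]
    infer_instance
  | succ n ih =>
    have : (S ^ (n + 1)).ker = (S ^ n).ker.comap (S : E →ₗ[ℂ] E) := by
      ext x
      change (S ^ (n + 1)) x = 0 ↔ (S ^ n) (S x) = 0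
      rw [pow_succ_apply]
    rw [this]
    infer_instance

theorem IsWeyl.isUpperSemiWeyl {S : E →L[ℂ] E} (h : IsWeyl S) : IsUpperSemiWeyl S :=
  ⟨⟨nullity_lt_top_iff.2 h.1.finite_ker, h.1.isClosed_range⟩, h.2.le⟩

variable [CompleteSpace E]

/-- Neumann's lemma for `S ^ m` and `ker S`: their sum is the preimage under `S` of the range of
`S ^ (m + 1)`. -/
theorem isClosed_range_pow_of_succ {S : E →L[ℂ] E} {m : ℕ}
    (hm : (S ^ m).ker = (S ^ (m + 1)).ker) (h : IsClosed ((S ^ (m + 1)).range : Set E)) :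
    IsClosed ((S ^ m).range : Set E) := by
  refine isClosed_range_of_disjoint_of_isClosed_sup (S ^ m) S.ker S.isClosed_ker
    (disjoint_ker_range_pow_iff.2 hm).symm ?_
  rw [← Submodule.comap_map_eq, ← range_pow_succ]
  exact h.preimage S.continuous

theorem isClosed_range_pow_of_le {S : E →L[ℂ] E} {p m n : ℕ}
    (hp : (S ^ p).ker = (S ^ (p + 1)).ker) (hpm : p ≤ m) (hmn : m ≤ n)
    (h : IsClosed ((S ^ n).range : Set E)) : IsClosed ((S ^ m).range : Set E) := by
  induction n, hmn using Nat.le_induction with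
  | base => exact h
  | succ n hn ih =>
    refine ih (isClosed_range_pow_of_succ ?_ h)
    rw [ker_pow_eq_of_le hp (hpm.trans hn), ker_pow_eq_of_le hp (n := n + 1) (by omega)]

theorem isLeftDrazinInvertible_of_isClosed {S : E →L[ℂ] E} {n : ℕ}
    (hn : (S ^ n).ker = (S ^ (n + 1)).ker) (h : IsClosed ((S ^ (n + 1)).range : Set E)) :
    IsLeftDrazinInvertible S := by
  have ha := ascent_le hn
  obtain ⟨p, hp, hk⟩ := exists_ascent_eq (ha.trans_lt (ENat.natCast_lt_top n))
  have hpn : p ≤ n := by rw [hp] at ha; exact_mod_cast ha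
  exact ⟨p, hp, isClosed_range_pow_of_le hk (by omega) (by omega) h⟩

theorem IsDrazinInvertible.exists_isCompl_isClosed {S : E →L[ℂ] E} (h : IsDrazinInvertible S) :
    ∃ n : ℕ, (S ^ n).ker = (S ^ (n + 1)).ker ∧ (S ^ n).range = (S ^ (n + 1)).range ∧
      IsCompl (S ^ n).ker (S ^ n).range ∧ IsClosed ((S ^ n).range : Set E) := by
  obtain ⟨n, hk, hr, hc⟩ := h.exists_isCompl
  refine ⟨n, hk, hr, hc, isClosed_range_of_disjoint_of_isClosed_sup (S ^ n) (S ^ n).ker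
    (S ^ n).isClosed_ker hc.disjoint.symm ?_⟩
  rw [sup_comm, hc.sup_eq_top]
  exact isClosed_univ

theorem IsDrazinInvertible.isLeftDrazinInvertible {S : E →L[ℂ] E} (h : IsDrazinInvertible S) :
    IsLeftDrazinInvertible S := by
  obtain ⟨n, hk, hr, -, hcl⟩ := h.exists_isCompl_isClosed
  exact isLeftDrazinInvertible_of_isClosed hk (by rwa [← hr])

/-- If `p` is the ascent of `S`, then `S_[p]` is injective with closed range. -/
theorem IsLeftDrazinInvertible.isUpperSemiBWeyl {S : E →L[ℂ] E} (h : IsLeftDrazinInvertible S) :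
    IsUpperSemiBWeyl S := by
  obtain ⟨p, hp, hcl⟩ := h
  obtain ⟨p', hp', hk⟩ := exists_ascent_eq (hp.trans_lt (ENat.natCast_lt_top p))
  obtain rfl : p' = p := by rw [hp] at hp'; exact_mod_cast hp'.symm
  have hcl' := isClosed_range_pow_of_succ hk hcl
  have h0 := nullity_eq_zero_iff.2 (restrictRangePow_injective_iff.2 hk)
  refine ⟨p', hcl', ⟨by rw [h0]; exact ENat.natCast_lt_top 0, ?_⟩, ?_⟩
  · rwa [isClosed_range_restrictRangePow_iff hcl']
  · rw [index_nonpos_iff, h0]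
    exact zero_le

/-- A Fredholm operator in the sense of finite-dimensional kernel, closed range and
finite-dimensional cokernel is Fredholm in the sense of topological homomorphisms. -/
theorem isFredholm_of_finite {S : E →L[ℂ] E} (hk : FiniteDimensional ℂ S.ker)
    (hcl : IsClosed (S.range : Set E)) (hc : FiniteDimensional ℂ (E ⧸ S.range)) :
    S.IsFredholm where
  isStrictMap := by
    have : CompleteSpace S.range := hcl.completeSpace_coe
    exact S.rangeRestrict.isQuotientMap (LinearMap.surjective_rangeRestrict _)
  isClosed_range := hcl
  finite_ker := hk
  finite_coker := hc
  closedComplemented_ker := Submodule.ClosedComplemented.of_finiteDimensional _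

/-- The range `K` of a high power of `S` has finite codimension `d`, meets the kernel trivially
and satisfies `S K = K`; counting dimensions modulo `K` gives `d + β = α + d`. -/
theorem IsDrazinInvertible.isWeyl {S : E →L[ℂ] E} (h : IsDrazinInvertible S)
    (hk : FiniteDimensional ℂ S.ker) : IsWeyl S := by
  obtain ⟨n, hkn, hrn, hcompl, hcl⟩ := h.exists_isCompl_isClosed
  have hkn' := finiteDimensional_ker_pow hk n
  have hd : FiniteDimensional ℂ (E ⧸ (S ^ n).range) :=
    (Submodule.quotientEquivOfIsCompl _ _ hcompl.symm).symm.finiteDimensional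
  have e := congrArg toENat (rank_quotient_add_rank_quotient_range (S : E →ₗ[ℂ] E) (S ^ n).range
    (disjoint_ker_range_pow_iff.2 hkn).symm)
  rw [← range_pow_succ, ← hrn, map_add, map_add, add_comm] at e
  have hfin : toENat (Module.rank ℂ (E ⧸ (S ^ n).range)) ≠ ⊤ :=
    (toENat_lt_top.2 (Module.rank_lt_aleph0_iff.2 hd)).ne
  have e' : deficiency S = nullity S := (ENat.add_left_injective_of_ne_top hfin) e
  have hnull := nullity_lt_top_iff.2 hk
  have hc : FiniteDimensional ℂ (E ⧸ S.range) := by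
    rw [← deficiency_lt_top_iff, e']
    exact hnull
  refine ⟨isFredholm_of_finite hk ?_ hc, (index_eq_zero_iff hnull).2 e'.symm⟩
  have hle : (S ^ n).range ≤ S.range := by
    rw [hrn, range_pow_succ]
    exact LinearMap.map_le_range
  exact Submodule.isClosed_mono_of_finiteDimensional_quotient hcl hle

/-- A pole has a punctured neighbourhood without eigenvalues: all eigenvectors for nonzero
eigenvalues lie in the range of `S ^ n`, on which `S` is bounded below for large `n`. -/
theorem IsDrazinInvertible.exists_injective_shift {S : E →L[ℂ] E} (h : IsDrazinInvertible S) :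
    ∃ ε > 0, ∀ μ : ℂ, μ ≠ 0 → ‖μ‖ < ε → Function.Injective (shift S μ) := by
  obtain ⟨n, hk, hr, -, hcl⟩ := h.exists_isCompl_isClosed
  have : CompleteSpace (S ^ n).range := hcl.completeSpace_coe
  have hb : IsBoundedBelow (restrictRangePow S n) := by
    rw [isBoundedBelow_iff]
    refine ⟨restrictRangePow_injective_iff.2 hk, ?_⟩
    rw [isClosed_range_restrictRangePow_iff hcl, ← hr]
    exact hcl
  obtain ⟨c, hc, hb⟩ := hb
  refine ⟨c, hc, fun μ hμ hμc => ?_⟩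
  rw [injective_iff_map_eq_zero]
  intro x hx
  have hx' : S x = μ • x := sub_eq_zero.1 hx
  have h1 : c * ‖x‖ ≤ ‖S x‖ := hb ⟨x, mem_range_pow_of_eq_smul hμ hx' n⟩
  rw [hx', norm_smul] at h1
  by_contra hne
  have := norm_pos_iff.2 hne
  nlinarith

end Drazin

/-! ### Upper semi-B-Weyl operators without small eigenvalues -/

section BWeyl

variable {E : Type*} [NormedAddCommGroup E] [NormedSpace ℂ E] [CompleteSpace E]

/-- If `R (S ^ n)` is closed and `S_[n]` is upper semi-Fredholm, then the ranges of all higher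
powers are closed. -/
theorem isClosed_range_pow_of_isUpperSemiFredholm {S : E →L[ℂ] E} {n m : ℕ}
    (hcl : IsClosed ((S ^ n).range : Set E)) (h : IsUpperSemiFredholm (restrictRangePow S n))
    (hm : n ≤ m) : IsClosed ((S ^ m).range : Set E) := by
  induction m, hm using Nat.le_induction with
  | base => exact hcl
  | succ m hm ih =>
    have : CompleteSpace (S ^ n).range := hcl.completeSpace_coe
    have hfin : FiniteDimensional ℂ (restrictRangePow S n).ker := nullity_lt_top_iff.1 h.1
    set N : Submodule ℂ (S ^ n).range := (S ^ m).range.comap (S ^ n).range.subtype with hN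
    have hNcl : IsClosed (N : Set (S ^ n).range) := ih.preimage continuous_subtype_val
    have h1 := isClosed_map_of_isClosed_sup_ker (restrictRangePow S n) h.2 N
      (Submodule.isClosed_sup_finiteDimensional _ _ hNcl)
    convert hcl.isClosedEmbedding_subtypeVal.isClosedMap _ h1 using 1
    ext y
    rw [range_pow_succ]
    constructor
    · rintro ⟨x, hx, rfl⟩
      have hxn : x ∈ (S ^ n).range := range_pow_antitone S hm hx
      exact ⟨restrictRangePow S n ⟨x, hxn⟩, ⟨⟨x, hxn⟩, hx, rfl⟩, rfl⟩
    · rintro ⟨_, ⟨x, hx, rfl⟩, rfl⟩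
      exact ⟨x, hx, rfl⟩

/-- If the ranges of high powers of `S` are closed, `ker S ∩ R (S ^ n)` is finite-dimensional, and
`ker S` meets the ranges of all powers, then every small `μ` is an eigenvalue of `S`. Indeed the
spaces `ker S ∩ R (S ^ k)` stabilize, so that the closed space `⋂ R (S ^ k)` meets `ker S` and is
mapped onto itself by `S`. -/
theorem exists_not_injective_shift {S : E →L[ℂ] E} {n : ℕ}
    (hcl : ∀ m ≥ n, IsClosed ((S ^ m).range : Set E))
    (hfin : FiniteDimensional ℂ (S.ker ⊓ (S ^ n).range : Submodule ℂ E))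
    (hne : ∀ m, ¬ Disjoint S.ker (S ^ m).range) :
    ∃ ε > 0, ∀ μ : ℂ, ‖μ‖ < ε → ¬ Function.Injective (shift S μ) := by
  obtain ⟨m, hnm, hstab⟩ : ∃ m ≥ n, ∀ k ≥ m,
      S.ker ⊓ (S ^ k).range = S.ker ⊓ (S ^ m).range := by
    obtain ⟨m, hm, hmin⟩ := WellFounded.has_min
      (measure fun m => Module.finrank ℂ (S.ker ⊓ (S ^ m).range : Submodule ℂ E)).wf
      {m | n ≤ m} ⟨n, le_refl n⟩
    refine ⟨m, hm, fun k hk => ?_⟩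
    have : FiniteDimensional ℂ (S.ker ⊓ (S ^ m).range : Submodule ℂ E) :=
      Submodule.finiteDimensional_of_le (inf_le_inf_left _ (range_pow_antitone S hm))
    refine Submodule.eq_of_le_of_finrank_le (inf_le_inf_left _ (range_pow_antitone S hk)) ?_
    exact not_lt.1 (hmin k (le_trans hm hk))
  set M : Submodule ℂ E := ⨅ k, (S ^ k).range with hM
  have hmemM : ∀ x, (∀ k ≥ m, x ∈ (S ^ k).range) → x ∈ M := fun x hx =>
    (Submodule.mem_iInf _).2 fun k =>
      range_pow_antitone S (le_max_left k m) (hx _ (le_max_right k m))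
  have hMcl : IsClosed (M : Set E) := by
    have : (M : Set E) = ⋂ k ≥ m, ((S ^ k).range : Set E) := by
      ext x
      simp only [Set.mem_iInter]
      exact ⟨fun hx k _ => (Submodule.mem_iInf _).1 hx k, hmemM x⟩
    rw [this]
    exact isClosed_biInter fun k hk => hcl k (le_trans hnm hk)
  have : CompleteSpace M := hMcl.completeSpace_coe
  have hmaps : ∀ x ∈ M, S x ∈ M := fun x hx => (Submodule.mem_iInf _).2 fun k =>
    mapsTo_range_pow S k x ((Submodule.mem_iInf _).1 hx k)
  set A : M →L[ℂ] M := (S.comp M.subtypeL).codRestrict M fun x => hmaps x x.2 with hA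
  have hsurj : Function.Surjective A := by
    rintro ⟨y, hy⟩
    have hpre : ∀ k, ∃ x ∈ (S ^ k).range, S x = y := by
      intro k
      have := (Submodule.mem_iInf _).1 hy (k + 1)
      rwa [range_pow_succ] at this
    obtain ⟨x, hx, hxy⟩ := hpre m
    -- Two preimages in `R (S ^ m)` differ by an element of `ker S ∩ R (S ^ m)`.
    have hxM : x ∈ M := by
      refine hmemM x fun k hk => ?_
      obtain ⟨x', hx', hxy'⟩ := hpre k
      have hd : x - x' ∈ S.ker ⊓ (S ^ m).range :=
        ⟨by change S (x - x') = 0; rw [map_sub, hxy, hxy', sub_self],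
          sub_mem hx (range_pow_antitone S hk hx')⟩
      rw [← hstab k hk] at hd
      simpa using add_mem hd.2 hx'
    exact ⟨⟨x, hxM⟩, Subtype.ext hxy⟩
  obtain ⟨x₀, hx₀, hx₀k⟩ : ∃ x₀ : M, x₀ ≠ 0 ∧ A x₀ = 0 := by
    have h := hne m
    rw [disjoint_iff, ← ne_eq, Submodule.ne_bot_iff] at h
    obtain ⟨x, hx, hx0⟩ := h
    have hxM : x ∈ M := hmemM x fun k hk => by
      rw [← hstab k hk] at hx
      exact hx.2
    exact ⟨⟨x, hxM⟩, fun h => hx0 (congrArg Subtype.val h), Subtype.ext hx.1⟩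
  obtain ⟨ε, hε, hev⟩ := exists_eigenvector_of_surjective A hsurj hx₀ hx₀k
  refine ⟨ε, hε, fun μ hμ hinj => ?_⟩
  obtain ⟨y, hy, hSy⟩ := hev μ hμ
  have hSy' : S y = μ • (y : E) := congrArg Subtype.val hSy
  refine hy (Subtype.ext (hinj ?_))
  rw [shift_apply, hSy', sub_self]
  simp

/-- An upper semi-B-Weyl operator is left Drazin invertible unless all small `μ` are eigenvalues;
in the latter case they are eigenvalues for which `S - μ` is upper semi-Weyl. -/
theorem IsUpperSemiBWeyl.isLeftDrazinInvertible_or {S : E →L[ℂ] E} (h : IsUpperSemiBWeyl S) :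
    IsLeftDrazinInvertible S ∨ ∃ ε > 0, ∀ μ : ℂ, μ ≠ 0 → ‖μ‖ < ε →
      IsUpperSemiWeyl (shift S μ) ∧ ¬ Function.Injective (shift S μ) := by
  obtain ⟨n, hcl, hF, hi⟩ := h
  have : CompleteSpace (S ^ n).range := hcl.completeSpace_coe
  have hclm : ∀ m ≥ n, IsClosed ((S ^ m).range : Set E) := fun m hm =>
    isClosed_range_pow_of_isUpperSemiFredholm hcl hF hm
  by_cases hd : ∃ m, Disjoint S.ker (S ^ m).range
  · left
    obtain ⟨m, hm⟩ := hd
    have hk := disjoint_ker_range_pow_iff.1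
      (hm.mono_right (range_pow_antitone S (le_max_left m n)))
    exact isLeftDrazinInvertible_of_isClosed hk (hclm _ (by omega))
  · right
    push Not at hd
    have hfin : FiniteDimensional ℂ (S.ker ⊓ (S ^ n).range : Submodule ℂ E) := by
      have h1 : FiniteDimensional ℂ (restrictRangePow S n).ker := nullity_lt_top_iff.1 hF.1
      have h2 : (S.ker ⊓ (S ^ n).range : Submodule ℂ E) ≤
          (restrictRangePow S n).ker.map (S ^ n).range.subtype :=
        fun x hx => ⟨⟨x, hx.2⟩, Subtype.ext hx.1, rfl⟩
      exact Submodule.finiteDimensional_of_le h2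
    obtain ⟨ε₁, hε₁, h₁⟩ := exists_not_injective_shift hclm hfin hd
    obtain ⟨ε₂, hε₂, h₂⟩ := IsUpperSemiWeyl.exists_isUpperSemiWeyl_shift ⟨hF, hi⟩
    refine ⟨min ε₁ ε₂, lt_min hε₁ hε₂, fun μ hμ hμε => ⟨?_, h₁ μ (hμε.trans_le (min_le_left _ _))⟩⟩
    exact isUpperSemiWeyl_shift_of_restrictRangePow hμ (h₂ μ (hμε.trans_le (min_le_right _ _)))

end BWeyl

/-! ### Parts of the spectrum -/

section Spectra

variable {X : Type*} [NormedAddCommGroup X] [NormedSpace ℂ X] {T : X →L[ℂ] X}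

theorem mem_approxSpectrum_of_not_injective {μ : ℂ} (h : ¬ Function.Injective (shift T μ)) :
    μ ∈ approxSpectrum T := by
  rintro ⟨c, hc, hb⟩
  refine h ((injective_iff_map_eq_zero _).2 fun x hx => ?_)
  have := hb x
  rw [hx, norm_zero] at this
  exact norm_le_zero_iff.1 (by nlinarith [norm_nonneg x])

theorem deltaA_subset_deltaAG : deltaA T ⊆ deltaAG T := fun _ h =>
  ⟨h.1, not_not.2 (not_not.1 h.2).isUpperSemiBWeyl⟩

variable [CompleteSpace X]

theorem mem_spectrum_iff {μ : ℂ} : μ ∈ spectrum ℂ T ↔ ¬ Function.Bijective (shift T μ) := by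
  rw [spectrum.mem_iff, ← ContinuousLinearMap.isUnit_iff_bijective, IsUnit.sub_iff]
  rfl

theorem not_injective_of_mem_poles {μ : ℂ} (h : μ ∈ poles T) :
    ¬ Function.Injective (shift T μ) := fun hi =>
  mem_spectrum_iff.1 h.1 ⟨hi, (not_not.1 h.2).surjective_of_injective hi⟩

theorem poles_subset_leftPoles : poles T ⊆ leftPoles T := fun _ h =>
  ⟨mem_approxSpectrum_of_not_injective (not_injective_of_mem_poles h),
    not_not.2 (not_not.1 h.2).isLeftDrazinInvertible⟩

theorem leftPoles_subset_deltaAG : leftPoles T ⊆ deltaAG T := fun _ h =>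
  ⟨h.1, not_not.2 (not_not.1 h.2).isUpperSemiBWeyl⟩

theorem delta_subset_deltaA : delta T ⊆ deltaA T := by
  rintro μ ⟨hs, hw⟩
  have hw : IsWeyl (shift T μ) := not_not.1 hw
  refine ⟨mem_approxSpectrum_of_not_injective fun hi => ?_, not_not.2 hw.isUpperSemiWeyl⟩
  have h0 := nullity_eq_zero_iff.2 hi
  have hd := (index_eq_zero_iff (nullity_lt_top_iff.2 hw.1.finite_ker)).1 hw.2
  rw [h0] at hd
  exact mem_spectrum_iff.1 hs ⟨hi, deficiency_eq_zero_iff.1 hd.symm⟩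

theorem deltaA_inter_poles_subset_delta : deltaA T ∩ poles T ⊆ delta T := fun _ h =>
  ⟨h.2.1, not_not.2 ((not_not.1 h.2.2).isWeyl (nullity_lt_top_iff.1 (not_not.1 h.1.2).1.1))⟩

/-- If all points of `Δ_a(T)` are poles, then all points of `Δ_a^g(T)` are left poles: otherwise
there would be a disc of eigenvalues which, apart from its centre, lie in `Δ_a(T)`, and near each
of these poles there are no other eigenvalues. -/
theorem deltaAG_subset_leftPoles (h : deltaA T ⊆ poles T) : deltaAG T ⊆ leftPoles T := by
  rintro μ ⟨ha, hb⟩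
  refine ⟨ha, not_not.2 ?_⟩
  refine (not_not.1 hb : IsUpperSemiBWeyl (shift T μ)).isLeftDrazinInvertible_or.resolve_right ?_
  rintro ⟨ε, hε, hμ⟩
  simp only [shift_shift] at hμ
  -- The point `μ + ν` of the disc is a pole, and `μ + ν + η` is an eigenvalue too close to it.
  set ν : ℂ := ((ε / 2 : ℝ) : ℂ) with hν
  have hνn : ‖ν‖ = ε / 2 := by rw [hν, Complex.norm_real, Real.norm_of_nonneg (by positivity)]
  have hν0 : ν ≠ 0 := norm_pos_iff.1 (by rw [hνn]; positivity)
  obtain ⟨hw, hni⟩ := hμ ν hν0 (by rw [hνn]; linarith)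
  have hp : μ + ν ∈ poles T := h ⟨mem_approxSpectrum_of_not_injective hni, not_not.2 hw⟩
  obtain ⟨δ, hδ, hiso⟩ := (not_not.1 hp.2).exists_injective_shift
  set η : ℂ := ((min (ε / 4) (δ / 2) : ℝ) : ℂ) with hη
  have hm : 0 < min (ε / 4) (δ / 2) := by positivity
  have hηn : ‖η‖ = min (ε / 4) (δ / 2) := by
    rw [hη, Complex.norm_real, Real.norm_of_nonneg hm.le]
  have hη0 : η ≠ 0 := norm_pos_iff.1 (by rw [hηn]; exact hm)
  have h1 : ‖η‖ ≤ ε / 4 := hηn.trans_le (min_le_left _ _)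
  have h2 : ‖η‖ ≤ δ / 2 := hηn.trans_le (min_le_right _ _)
  have hinj := hiso η hη0 (by linarith)
  rw [shift_shift, add_assoc] at hinj
  refine (hμ (ν + η) (fun h0 => ?_) ?_).2 hinj
  · have := congrArg norm (eq_neg_of_add_eq_zero_left h0)
    rw [norm_neg, hνn] at this
    linarith
  · have := norm_add_le ν η
    linarith

end Spectra

end WeylType

theorem mainTheorem3 {X : Type*} [NormedAddCommGroup X] [NormedSpace ℂ X] [CompleteSpace X]
    (hX : ¬ FiniteDimensional ℂ X) (T : X →L[ℂ] X) :
    (WeylType.PropertyGB T → (WeylType.PropertyUWPi T ↔ WeylType.PropertyZPiA T)) ∧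
    (WeylType.PropertyUWPi T ∧ WeylType.PropertyZPiA T → WeylType.PropertyGB T) ∧
    (WeylType.PropertyZPiA T → WeylType.poles T ⊆ WeylType.deltaA T) := by
  open WeylType in
  have hiii : PropertyZPiA T → poles T ⊆ deltaA T := fun hZ =>
    (poles_subset_leftPoles.trans hZ.ge).trans delta_subset_deltaA
  refine ⟨fun hgb => ⟨fun hU => ?_, fun hZ => ?_⟩, fun ⟨hU, hZ⟩ => ?_, hiii⟩
  · have hlp : leftPoles T ⊆ poles T := leftPoles_subset_deltaAG.trans hgb.le
    refine Set.Subset.antisymm ((delta_subset_deltaA.trans hU.le).trans poles_subset_leftPoles) ?_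
    exact fun μ hμ => deltaA_inter_poles_subset_delta ⟨hU.ge (hlp hμ), hlp hμ⟩
  · exact Set.Subset.antisymm (deltaA_subset_deltaAG.trans hgb.le) (hiii hZ)
  · refine Set.Subset.antisymm ?_ (hU.ge.trans deltaA_subset_deltaAG)
    calc deltaAG T ⊆ leftPoles T := deltaAG_subset_leftPoles hU.le
      _ = delta T := hZ.symm
      _ ⊆ deltaA T := delta_subset_deltaA
      _ = poles T := hU
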